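/- **Conventions.** $\mathbb{R}^n,\mathbb{R}^m$ carry the Euclidean norm, and $\mathbb{B}_r(a)$ is the closed ball of radius $r$ around $a$. For a set-valued map $S:\mathbb{R}^n\rightrightarrows\mathbb{R}^m$ let $\mathrm{Graph}(S)=\{(x,y): y\in S(x)\}$; $S$ is *closed* if $\mathrm{Graph}(S)$ is closed. For $C\subset\mathbb{R}^k$ and $a\in C$, the regular normal cone is $\hat N_C(a)=\{y:\langle y,x-a\rangle\le o(\|x-a\|)\text{ for } x\in C\}$; the limiting normal cone $N_C(a)$ consists of all limits of sequences $y_i\in\hat N_C(x_i)$ with $x_i\in C$, $x_i\to a$. The limiting coderivative $D^*S(x\mid y):\mathbb{R}^m\rightrightarrows\mathbb{R}^n$ at $(x,y)\in\mathrm{Graph}(S)$ is given by $v\in D^*S(x\mid y)(u)\iff(v,-u)\in N_{\mathrm{Graph}(S)}(x,y)$; it is the empty map if $(x,y)\notin\mathrm{Graph}(S)$. Unions and closed convex hulls $\overline{\mathrm{co}}$ of set-valued maps are taken pointwise. A *prefan* is a positively homogeneous map $H:\mathbb{R}^n\rightrightarrows\mathbb{R}^m$ with nonempty convex compact values such that $\|H\|^+:=\sup_{\|w\|\le1}\sup_{z\in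 H(w)}\|z\|<\infty$. For $D:\mathbb{R}^m\rightrightarrows\mathbb{R}^n$, let $\mathcal{H}(D)$ be the set of all prefans $H:\mathbb{R}^n\rightrightarrows\mathbb{R}^m$ such that $$\min_{y\in H(p)}\langle u,y\rangle\le\inf_{v\in\overline{\mathrm{co}}D(u)}\langle v,p\rangle\quad\text{for all }p\in\mathbb{R}^n\setminus\{0\},\ u\in\mathbb{R}^m,$$ where the infimum over the empty set is $+\infty$. **Lemma.** Let $\delta>0$, $\bar x\in\mathbb{R}^n$, $\bar y\in\mathbb{R}^m$, let $S:\mathbb{R}^n\rightrightarrows\mathbb{R}^m$ be a closed set-valued map, and let $H:\mathbb{R}^n\rightrightarrows\mathbb{R}^m$ be a prefan such that $$H\in\mathcal{H}\Big(\overline{\mathrm{co}}\bigcup_{x\in\mathbb{B}_\delta(\bar x),\;y\in\mathbb{B}_\delta(\bar y)}D^*S(x\mid y)\Big).$$ Let $\delta':=\min\big(\delta,\frac{\delta}{5\|H\|^+}\big)$, where $\frac{\delta}{0}:=+\infty$. Then $$S(x')\cap\mathbb{B}_{\delta/2}(\bar y)\subset S(x'')+H(x'-x'')\quad\text{for all }x',x''\in\mathbb{B}_{\delta'}(\bar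 x).$$ -/

import Mathlib

open Filter Topology Set
open scoped ENNReal Pointwise

namespace VarAnalysis

section NormalCones

variable {E : Type*} [NormedAddCommGroup E] [InnerProductSpace ℝ E]

/-- The regular normal cone to `C` at `a`: all `y` such that
`⟪y, x - a⟫ ≤ o(‖x - a‖)` for `x ∈ C`, `x → a`. It is empty when `a ∉ C`. -/
def regularNormalCone (C : Set E) (a : E) : Set E :=
  {y | a ∈ C ∧ ∀ ε : ℝ, 0 < ε → ∀ᶠ x in 𝓝[C] a, inner ℝ y (x - a) ≤ ε * ‖x - a‖}

/-- The limiting (Mordukhovich) normal cone to `C` at `a`: all limits of regular normals at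
points of `C` converging to `a`. -/
def limitingNormalCone (C : Set E) (a : E) : Set E :=
  {y | ∃ (xs ys : ℕ → E), (∀ i, xs i ∈ C) ∧ Tendsto xs atTop (𝓝 a) ∧
    (∀ i, ys i ∈ regularNormalCone C (xs i)) ∧ Tendsto ys atTop (𝓝 y)}

end NormalCones

section SetValuedMaps

variable {E F : Type*} [NormedAddCommGroup E] [InnerProductSpace ℝ E]
  [NormedAddCommGroup F] [InnerProductSpace ℝ F]

/-- The graph of a set-valued map `S : E ⇉ F`, in the product `E × F` with the inner product
`⟪(x, y), (x', y')⟫ = ⟪x, x'⟫ + ⟪y, y'⟫`. -/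
def graph (S : E → Set F) : Set (WithLp 2 (E × F)) :=
  {z | z.snd ∈ S z.fst}

/-- A set-valued map is closed if its graph is closed. -/
def HasClosedGraph (S : E → Set F) : Prop :=
  IsClosed (graph S)

/-- The limiting (Mordukhovich) coderivative `D*S(x ∣ y) : F ⇉ E`:
`v ∈ D*S(x ∣ y)(u)` iff `(v, -u)` is a limiting normal to the graph of `S` at `(x, y)`. -/
def coderivative (S : E → Set F) (x : E) (y : F) : F → Set E :=
  fun u => {v | WithLp.toLp 2 (v, -u) ∈ limitingNormalCone (graph S) (WithLp.toLp 2 (x, y))}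

/-- The union of the maps `D*S(x ∣ y)` over `x` and `y` in the closed `δ`-balls around
`a` and `b`. -/
def coderivativeAround (S : E → Set F) (a : E) (b : F) (δ : ℝ) : F → Set E :=
  fun u => ⋃ x ∈ Metric.closedBall a δ, ⋃ y ∈ Metric.closedBall b δ, coderivative S x y u

/-- The pointwise closed convex hull of a set-valued map. -/
def closedConvexification (D : F → Set E) : F → Set E :=
  fun u => closedConvexHull ℝ (D u)

/-- The outer norm `‖H‖⁺ = sup_{‖w‖ ≤ 1} sup_{z ∈ H w} ‖z‖`, as an extended real in `[0, ∞]`. -/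
noncomputable def outerNorm (H : E → Set F) : ℝ≥0∞ :=
  ⨆ w ∈ Metric.closedBall (0 : E) 1, ⨆ z ∈ H w, ‖z‖ₑ

/-- Positive homogeneity of a set-valued map (its graph is a cone). -/
def IsPosHomogeneous (H : E → Set F) : Prop :=
  0 ∈ H 0 ∧ ∀ (c : ℝ) (w : E), 0 < c → H (c • w) = c • H w

/-- Prefans: positively homogeneous set-valued maps with nonempty convex compact values and
finite outer norm. -/
structure IsPrefan (H : E → Set F) : Prop where
  nonempty : ∀ p, (H p).Nonempty
  convex : ∀ p, Convex ℝ (H p)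
  isCompact : ∀ p, IsCompact (H p)
  posHomogeneous : IsPosHomogeneous H
  outerNorm_lt_top : outerNorm H < ⊤

/-- The generalized derivative set `𝓗(D)` of `D : F ⇉ E`: all prefans `H : E ⇉ F` with
`min_{y ∈ H p} ⟪u, y⟫ ≤ min_{v ∈ cl co D(u)} ⟪v, p⟫` for all `p ≠ 0` and all `u`.
The minima are written as infima in the extended reals, so the right-hand side is `+∞` when
`D(u)` is empty. -/
def genDerivSet (D : F → Set E) : Set (E → Set F) :=
  {H | IsPrefan H ∧ ∀ (p : E) (u : F), p ≠ 0 →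
    (⨅ y ∈ H p, ((inner ℝ u y : ℝ) : EReal)) ≤
      ⨅ v ∈ closedConvexification D u, ((inner ℝ v p : ℝ) : EReal)}

end SetValuedMaps

end VarAnalysis

/-! Put `p = x' - x''` and let `W` consist of the vectors `(-p, -k)` with `k ∈ H p`, a convex
compact set of velocities. A regular normal `(v, -u)` to the graph at a point of the δ-balls has
product `⟪u, k⟫ - ⟪v, p⟫ ≤ 0` with some element of `W`, by membership in `𝓗`. An Euler polygon that
at each step projects onto the graph and picks such a velocity then stays near the graph: the cross
term in the squared distance is nonpositive, so after `N` steps of length `1/N` that distance is at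
most `M²/N`. As `W` is convex and fixed, the endpoint is the start plus an element of `W`, and
compactness puts such an endpoint on the graph (`exists_add_mem_of_regularNormal_aiming`). Aiming
needs a tube inside the δ-balls, but `x'` and `x''` may lie on the sphere. So the motion starts from
a nearby graph point over the open ball, stops slightly early, and a limit is taken
(`inter_closedBall_subset_add`). -/

namespace VarAnalysis

/-! ### Proximal aiming and viability of a closed set -/

section Viability

variable {G : Type*} [NormedAddCommGroup G] [InnerProductSpace ℝ G]

/-- A compact set and a closed set at distance zero intersect. -/
theorem inter_nonempty_of_forall_dist_lt {X : Type*} [PseudoMetricSpace X] {T C : Set X}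
    (hT : IsCompact T) (hC : IsClosed C)
    (h : ∀ ε : ℝ, 0 < ε → ∃ t ∈ T, ∃ c ∈ C, dist t c < ε) : (T ∩ C).Nonempty := by
  by_contra hne
  have hd : Disjoint T C := by
    rw [Set.disjoint_iff_inter_eq_empty]
    exact Set.not_nonempty_iff_eq_empty.mp hne
  obtain ⟨ε, hε, hdis⟩ := hd.exists_thickenings hT hC
  obtain ⟨t, ht, c, hc, htc⟩ := h ε hε
  refine Set.disjoint_left.mp hdis (Metric.mem_thickening_iff.mpr ⟨t, ht, ?_⟩)
    (Metric.self_subset_thickening hε C hc)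
  rwa [dist_comm]

theorem mem_regularNormalCone_of_quadratic {C : Set G} {s y : G} (hs : s ∈ C)
    (h : ∀ᶠ x in 𝓝[C] s, 2 * inner ℝ y (x - s) ≤ ‖x - s‖ ^ 2) : y ∈ regularNormalCone C s := by
  refine ⟨hs, fun ε hε => ?_⟩
  filter_upwards [h, mem_nhdsWithin_of_mem_nhds (Metric.ball_mem_nhds s hε)] with x hx hxs
  rw [Metric.mem_ball, dist_eq_norm] at hxs
  nlinarith [norm_nonneg (x - s)]

theorem sub_mem_regularNormalCone_of_forall_dist_le {C : Set G} {s z : G} (hs : s ∈ C)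
    (h : ∀ x ∈ C, dist z s ≤ dist z x) : z - s ∈ regularNormalCone C s := by
  refine mem_regularNormalCone_of_quadratic hs ?_
  filter_upwards [self_mem_nhdsWithin] with x hx
  have h1 := h x hx
  rw [dist_eq_norm, dist_eq_norm] at h1
  have h2 : ‖z - x‖ ^ 2 = ‖z - s‖ ^ 2 - 2 * inner ℝ (z - s) (x - s) + ‖x - s‖ ^ 2 := by
    rw [← norm_sub_sq_real]; congr 2; abel
  nlinarith [norm_nonneg (z - s)]

theorem regularNormalCone_subset_limitingNormalCone (C : Set G) (a : G) :
    regularNormalCone C a ⊆ limitingNormalCone C a := fun y hy =>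
  ⟨fun _ => a, fun _ => y, fun _ => hy.1, tendsto_const_nhds, fun _ => hy, tendsto_const_nhds⟩

/-- One run of the Euler polygon with proximal aiming. -/
theorem exists_euler_polygon [ProperSpace G] {C W : Set G} (hC : IsClosed C) (hW : Convex ℝ W)
    {z₀ : G} (hz₀ : z₀ ∈ C) {η M : ℝ} (hη : 0 < η) (hM : ∀ w ∈ W, ‖w‖ ≤ M)
    (haim : ∀ s ∈ C, (∃ t ∈ Icc (0 : ℝ) 1, ∃ w ∈ W, dist s (z₀ + t • w) ≤ η) →
      ∀ ν ∈ regularNormalCone C s, ∃ w ∈ W, inner ℝ ν w ≤ 0)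
    (hWne : W.Nonempty) {N : ℕ} (hN : 0 < N) (hNη : M ^ 2 / N ≤ η ^ 2) (i : ℕ) (hi : i ≤ N) :
    ∃ w ∈ W, ∃ s ∈ C, dist (z₀ + ((i : ℝ) / N) • w) s ^ 2 ≤ i * (M ^ 2 / N ^ 2) := by
  have hN' : (0 : ℝ) < N := by exact_mod_cast hN
  induction i with
  | zero =>
    obtain ⟨w, hw⟩ := hWne
    exact ⟨w, hw, z₀, hz₀, by simp⟩
  | succ i ih =>
    obtain ⟨w, hw, s', hs', hd'⟩ := ih (by omega)
    obtain ⟨s, hs, hmin⟩ := hC.exists_infDist_eq_dist ⟨z₀, hz₀⟩ (z₀ + ((i : ℝ) / N) • w)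
    set z := z₀ + ((i : ℝ) / N) • w with hz
    have hle : ∀ x ∈ C, dist z s ≤ dist z x := fun x hx =>
      hmin ▸ Metric.infDist_le_dist_of_mem hx
    have hd : dist z s ^ 2 ≤ i * (M ^ 2 / N ^ 2) :=
      (pow_le_pow_left₀ dist_nonneg (hle s' hs') 2).trans hd'
    have hiN : (i : ℝ) ≤ N := by exact_mod_cast (by omega : i ≤ N)
    have hdη : dist z s ≤ η := by
      refine le_of_pow_le_pow_left₀ two_ne_zero hη.le ?_
      calc dist z s ^ 2 ≤ i * (M ^ 2 / N ^ 2) := hd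
        _ ≤ N * (M ^ 2 / N ^ 2) := by gcongr
        _ = M ^ 2 / N := by field_simp
        _ ≤ η ^ 2 := hNη
    -- The projection residual `z - s` is a regular normal at `s`, so a velocity `f` not pointing
    -- along it exists.
    obtain ⟨f, hf, hfin⟩ := haim s hs
      ⟨(i : ℝ) / N, ⟨by positivity, (div_le_one hN').mpr hiN⟩, w, hw, by rwa [dist_comm]⟩
      (z - s) (sub_mem_regularNormalCone_of_forall_dist_le hs hle)
    have hi1 : (0 : ℝ) < (i : ℝ) + 1 := by positivity
    -- The new `w` is the running average of the velocities chosen so far.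
    refine ⟨((i : ℝ) / (i + 1)) • w + ((1 : ℝ) / (i + 1)) • f,
      hW hw hf (by positivity) (by positivity) (by field_simp), s, hs, ?_⟩
    have hstep : z₀ + (((i + 1 : ℕ) : ℝ) / N) •
        (((i : ℝ) / (i + 1)) • w + ((1 : ℝ) / (i + 1)) • f) - s
        = (z - s) + ((1 : ℝ) / N) • f := by
      rw [hz, smul_add, smul_smul, smul_smul]
      have e1 : ((i + 1 : ℕ) : ℝ) / N * ((i : ℝ) / (i + 1)) = i / N := by
        push_cast; field_simp
      have e2 : ((i + 1 : ℕ) : ℝ) / N * ((1 : ℝ) / (i + 1)) = 1 / N := by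
        push_cast; field_simp
      rw [e1, e2]; abel
    rw [dist_eq_norm, hstep, norm_add_sq_real, inner_smul_right, norm_smul, mul_pow]
    rw [dist_eq_norm] at hd
    have h1 : (1 : ℝ) / N * inner ℝ (z - s) f ≤ 0 :=
      mul_nonpos_of_nonneg_of_nonpos (by positivity) hfin
    have h2 : ‖(1 : ℝ) / N‖ ^ 2 * ‖f‖ ^ 2 ≤ M ^ 2 / N ^ 2 := by
      rw [Real.norm_of_nonneg (by positivity), div_pow, one_pow, div_mul_eq_mul_div, one_mul]
      have := hM f hf
      gcongr
    push_cast
    linarith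

/-- Viability of a closed set for a constant convex compact velocity set, under a regular normal
condition near the reachable tube. -/
theorem exists_add_mem_of_regularNormal_aiming [ProperSpace G] {C W : Set G} (hC : IsClosed C)
    (hW : Convex ℝ W) (hWc : IsCompact W) {z₀ : G} (hz₀ : z₀ ∈ C) (hWne : W.Nonempty)
    {η : ℝ} (hη : 0 < η)
    (haim : ∀ s ∈ C, (∃ t ∈ Icc (0 : ℝ) 1, ∃ w ∈ W, dist s (z₀ + t • w) ≤ η) →
      ∀ ν ∈ regularNormalCone C s, ∃ w ∈ W, inner ℝ ν w ≤ 0) :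
    ∃ w ∈ W, z₀ + w ∈ C := by
  obtain ⟨M, hM⟩ := hWc.isBounded.exists_norm_le
  have hT : IsCompact ((fun w => z₀ + w) '' W) := hWc.image (by fun_prop)
  obtain ⟨_, ⟨w, hw, rfl⟩, hwC⟩ := inter_nonempty_of_forall_dist_lt hT hC (fun ε hε => by
    have hlim : Tendsto (fun N : ℕ => M ^ 2 / (N : ℝ)) atTop (𝓝 0) :=
      tendsto_const_div_atTop_nhds_zero_nat _
    obtain ⟨N, hN1, hN2, hN3⟩ := ((hlim.eventually_le_const (pow_pos hη 2)).and
      ((hlim.eventually_lt_const (pow_pos hε 2)).and (eventually_gt_atTop 0))).exists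
    obtain ⟨w, hw, s, hs, hd⟩ :=
      exists_euler_polygon hC hW hz₀ hη hM haim hWne hN3 hN1 N le_rfl
    have hN' : (N : ℝ) ≠ 0 := by positivity
    refine ⟨z₀ + w, ⟨w, hw, rfl⟩, s, hs, ?_⟩
    rw [div_self hN', one_smul] at hd
    refine lt_of_pow_lt_pow_left₀ 2 hε.le (hd.trans_lt ?_)
    calc (N : ℝ) * (M ^ 2 / N ^ 2) = M ^ 2 / N := by field_simp
      _ < ε ^ 2 := hN2)
  exact ⟨w, hw, hwC⟩

end Viability

/-! ### Transport along the graph of a set-valued map -/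

section SetValuedMaps

variable {E F : Type*} [NormedAddCommGroup E] [InnerProductSpace ℝ E]
  [NormedAddCommGroup F] [InnerProductSpace ℝ F]

theorem inner_eq_fst_add_snd (x y : WithLp 2 (E × F)) :
    (inner ℝ x y : ℝ) = inner ℝ x.fst y.fst + inner ℝ x.snd y.snd :=
  WithLp.prod_inner_apply x y

theorem IsPosHomogeneous.enorm_le {H : E → Set F} (hH : IsPosHomogeneous H) {p : E} (hp : p ≠ 0)
    {k : F} (hk : k ∈ H p) : ‖k‖ₑ ≤ outerNorm H * ‖p‖ₑ := by
  have hp' : 0 < ‖p‖ := norm_pos_iff.mpr hp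
  have h1 : H p = ‖p‖ • H (‖p‖⁻¹ • p) := by
    rw [← hH.2 _ _ hp', smul_smul, mul_inv_cancel₀ hp'.ne', one_smul]
  rw [h1] at hk
  obtain ⟨z, hz, rfl⟩ := hk
  have hw : ‖p‖⁻¹ • p ∈ Metric.closedBall (0 : E) 1 := by
    rw [mem_closedBall_zero_iff, norm_smul, norm_inv, norm_norm, inv_mul_cancel₀ hp'.ne']
  have hz' : ‖z‖ₑ ≤ outerNorm H :=
    le_iSup₂_of_le (f := fun w (_ : w ∈ Metric.closedBall (0 : E) 1) => ⨆ z ∈ H w, ‖z‖ₑ) _ hw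
      (le_iSup₂_of_le (f := fun z (_ : z ∈ H (‖p‖⁻¹ • p)) => ‖z‖ₑ) z hz le_rfl)
  simp only [enorm_smul, enorm_norm]
  rw [mul_comm]
  gcongr

/-- Membership in `𝓗` turned into an aiming condition for regular normals to the graph. -/
theorem exists_inner_le_of_mem_genDerivSet {S H : E → Set F} {a : E} {b : F} {δ : ℝ}
    (hH : H ∈ genDerivSet (closedConvexification (coderivativeAround S a b δ)))
    {s : WithLp 2 (E × F)} (h1 : s.fst ∈ Metric.closedBall a δ)
    (h2 : s.snd ∈ Metric.closedBall b δ) {v : E} {u : F}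
    (hν : WithLp.toLp 2 (v, -u) ∈ regularNormalCone (graph S) s) {p : E} (hp : p ≠ 0) :
    ∃ k ∈ H p, (inner ℝ u k : ℝ) ≤ inner ℝ v p := by
  obtain ⟨k, hk, hmin⟩ := (hH.1.isCompact p).exists_isMinOn (hH.1.nonempty p)
    (f := fun y => (inner ℝ u y : ℝ)) (by fun_prop)
  have hv : v ∈ coderivativeAround S a b δ u := by
    simp only [coderivativeAround, mem_iUnion]
    exact ⟨s.fst, h1, s.snd, h2, regularNormalCone_subset_limitingNormalCone _ _ hν⟩
  -- The hull is taken twice because `genDerivSet` convexifies its argument again.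
  have hv' : v ∈ closedConvexification (closedConvexification (coderivativeAround S a b δ)) u :=
    subset_closedConvexHull (subset_closedConvexHull hv)
  have h3 := (hH.2 p u hp).trans (iInf₂_le v hv')
  have h4 : ((inner ℝ u k : ℝ) : EReal) ≤ ⨅ y ∈ H p, ((inner ℝ u y : ℝ) : EReal) :=
    le_iInf₂ fun y hy => EReal.coe_le_coe_iff.mpr (hmin hy)
  exact ⟨k, hk, EReal.coe_le_coe_iff.mp (h4.trans h3)⟩

/-- Graph points over the closed ball are limits of graph points over the open ball. -/
theorem exists_graph_dist_lt_fst_mem_ball {S H : E → Set F} {a : E} {b : F} {δ : ℝ} (hδ : 0 < δ)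
    (hH : H ∈ genDerivSet (closedConvexification (coderivativeAround S a b δ)))
    {z : WithLp 2 (E × F)} (hz : z ∈ graph S) (h1 : z.fst ∈ Metric.closedBall a δ)
    (h2 : z.snd ∈ Metric.closedBall b δ) {ε : ℝ} (hε : 0 < ε) :
    ∃ s ∈ graph S, dist s z < ε ∧ s.fst ∈ Metric.ball a δ := by
  by_contra! hno
  have hza : δ ≤ ‖z.fst - a‖ := by
    have := hno z hz (by simpa using hε)
    rwa [Metric.mem_ball, not_lt, dist_eq_norm] at this
  have hza' : ‖z.fst - a‖ = δ := le_antisymm (by simpa [dist_eq_norm] using h1) hza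
  have hp : z.fst - a ≠ 0 := norm_pos_iff.mp (hδ.trans_le hza)
  -- If all graph points near `z` lie over the complement of the open ball, the inward radial vector
  -- is normal to the graph; `u = 0` and `p = z.fst - a` then give `0 ≤ -δ²`.
  have hν : WithLp.toLp 2 (-(z.fst - a), -(0 : F)) ∈ regularNormalCone (graph S) z := by
    refine mem_regularNormalCone_of_quadratic hz ?_
    filter_upwards [self_mem_nhdsWithin,
      mem_nhdsWithin_of_mem_nhds (Metric.ball_mem_nhds z hε)] with x hx hxz
    have hxa := hno x hx hxz
    rw [Metric.mem_ball, not_lt, dist_eq_norm] at hxa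
    have e : x.fst - a = (z.fst - a) + (x.fst - z.fst) := by abel
    have h3 := norm_add_sq_real (z.fst - a) (x.fst - z.fst)
    rw [← e, hza'] at h3
    have h4 : δ ^ 2 ≤ ‖x.fst - a‖ ^ 2 := pow_le_pow_left₀ hδ.le hxa 2
    rw [WithLp.prod_norm_sq_eq_of_L2, inner_eq_fst_add_snd]
    simp only [WithLp.toLp_fst, WithLp.toLp_snd, WithLp.sub_fst, WithLp.sub_snd, neg_zero, inner_zero_left,
      inner_neg_left]
    nlinarith [sq_nonneg ‖x.snd - z.snd‖]
  obtain ⟨k, -, hk⟩ := exists_inner_le_of_mem_genDerivSet hH h1 h2 hν hp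
  rw [inner_zero_left, inner_neg_left, real_inner_self_eq_norm_sq, hza'] at hk
  nlinarith [pow_pos hδ 2]

/-- Moving from a graph point `z` in direction `-p`, up to the time `r`, along the graph. -/
theorem exists_graph_of_ball_tube [FiniteDimensional ℝ E] [FiniteDimensional ℝ F]
    {S H : E → Set F} {a : E} {b : F} {δ : ℝ} (hS : HasClosedGraph S)
    (hH : H ∈ genDerivSet (closedConvexification (coderivativeAround S a b δ)))
    {p : E} (hp : p ≠ 0) {r : ℝ} (hr : r ∈ Icc (0 : ℝ) 1) {z : WithLp 2 (E × F)}
    (hz : z ∈ graph S) (h0 : z.fst ∈ Metric.ball a δ) (h1 : z.fst - r • p ∈ Metric.ball a δ)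
    {R : ℝ} (hR : ∀ k ∈ H p, ‖k‖ ≤ R) (h2 : ‖z.snd - b‖ + R < δ) :
    ∃ k ∈ H p, z + r • WithLp.toLp 2 (-p, -k) ∈ graph S := by
  have : FiniteDimensional ℝ (WithLp 2 (E × F)) :=
    (WithLp.linearEquiv 2 ℝ (E × F)).symm.finiteDimensional
  have : ProperSpace (WithLp 2 (E × F)) := FiniteDimensional.proper ℝ _
  let W : Set (WithLp 2 (E × F)) := (fun k => r • WithLp.toLp 2 (-p, -k)) '' H p
  have hWc : IsCompact W := (hH.1.isCompact p).image (by fun_prop)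
  have hW : Convex ℝ W := by
    rintro _ ⟨k, hk, rfl⟩ _ ⟨l, hl, rfl⟩ α β hα hβ hαβ
    refine ⟨α • k + β • l, hH.1.convex p hk hl hα hβ hαβ, ?_⟩
    have e : WithLp.toLp 2 (-p, -(α • k + β • l)) =
        α • WithLp.toLp 2 (-p, -k) + β • WithLp.toLp 2 (-p, -l) := by
      rw [← WithLp.toLp_smul, ← WithLp.toLp_smul, ← WithLp.toLp_add, Prod.smul_mk, Prod.smul_mk,
        Prod.mk_add_mk, ← add_smul, hαβ, one_smul, smul_neg, smul_neg, neg_add]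
    simp only [e]
    module
  rw [Metric.mem_ball, dist_eq_norm] at h0 h1
  -- The margin left around the tube in each factor; in `E` the segment is farthest from `a` at an
  -- endpoint.
  set η := min (δ - max ‖z.fst - a‖ ‖z.fst - r • p - a‖) (δ - (‖z.snd - b‖ + R)) with hη
  have hη0 : 0 < η := lt_min (sub_pos.mpr (max_lt h0 h1)) (sub_pos.mpr h2)
  obtain ⟨_, ⟨k, hk, rfl⟩, hkC⟩ := exists_add_mem_of_regularNormal_aiming hS hW hWc hz
    ((hH.1.nonempty p).image _) hη0 (by
      rintro s hs ⟨t, ht, _, ⟨l, hl, rfl⟩, hd⟩ ν hν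
      rw [dist_eq_norm] at hd
      have hfst : ‖s.fst - (z.fst - (t * r) • p)‖ ≤ η := by
        refine le_trans ?_ hd
        refine le_trans (le_of_eq ?_) (WithLp.norm_fst_le (p := 2) _ _)
        simp [smul_smul, sub_eq_add_neg]
      have hsnd : ‖s.snd - (z.snd - (t * r) • l)‖ ≤ η := by
        refine le_trans ?_ hd
        refine le_trans (le_of_eq ?_) (WithLp.norm_snd_le (p := 2) _ _)
        simp [smul_smul, sub_eq_add_neg]
      have hs1 : s.fst ∈ Metric.closedBall a δ := by
        rw [mem_closedBall_iff_norm]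
        have hseg : ‖z.fst - (t * r) • p - a‖ ≤
            max ‖z.fst - a‖ ‖z.fst - r • p - a‖ := by
          have e : z.fst - (t * r) • p - a =
              (1 - t) • (z.fst - a) + t • (z.fst - r • p - a) := by module
          have h1t : 0 ≤ 1 - t := sub_nonneg.mpr ht.2
          rw [e]
          refine (norm_add_le _ _).trans ?_
          rw [norm_smul, norm_smul, Real.norm_of_nonneg h1t, Real.norm_of_nonneg ht.1]
          nlinarith [mul_le_mul_of_nonneg_left (le_max_left ‖z.fst - a‖ ‖z.fst - r • p - a‖) h1t,
            mul_le_mul_of_nonneg_left (le_max_right ‖z.fst - a‖ ‖z.fst - r • p - a‖) ht.1]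
        have e : s.fst - a = (s.fst - (z.fst - (t * r) • p)) + (z.fst - (t * r) • p - a) := by abel
        rw [e]
        linarith [norm_add_le (s.fst - (z.fst - (t * r) • p)) (z.fst - (t * r) • p - a),
          min_le_left (δ - max ‖z.fst - a‖ ‖z.fst - r • p - a‖) (δ - (‖z.snd - b‖ + R))]
      have hs2 : s.snd ∈ Metric.closedBall b δ := by
        rw [mem_closedBall_iff_norm]
        have htr : ‖(t * r) • l‖ ≤ R := by
          have h0tr : 0 ≤ t * r := mul_nonneg ht.1 hr.1
          rw [norm_smul, Real.norm_of_nonneg h0tr]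
          exact (mul_le_of_le_one_left (norm_nonneg _) (mul_le_one₀ ht.2 hr.1 hr.2)).trans (hR l hl)
        have e : s.snd - b = (s.snd - (z.snd - (t * r) • l)) + ((z.snd - b) - (t * r) • l) := by
          abel
        rw [e]
        linarith [norm_add_le (s.snd - (z.snd - (t * r) • l)) ((z.snd - b) - (t * r) • l),
          norm_sub_le (z.snd - b) ((t * r) • l),
          min_le_right (δ - max ‖z.fst - a‖ ‖z.fst - r • p - a‖) (δ - (‖z.snd - b‖ + R))]
      have hν' : WithLp.toLp 2 (ν.fst, -(-ν.snd)) ∈ regularNormalCone (graph S) s := by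
        rw [neg_neg]; exact hν
      obtain ⟨k, hk, hle⟩ := exists_inner_le_of_mem_genDerivSet hH hs1 hs2 hν' hp
      refine ⟨_, ⟨k, hk, rfl⟩, ?_⟩
      rw [inner_smul_right]
      refine mul_nonpos_of_nonneg_of_nonpos hr.1 ?_
      rw [inner_eq_fst_add_snd]
      simp only [WithLp.toLp_fst, WithLp.toLp_snd, inner_neg_right, inner_neg_left] at hle ⊢
      linarith)
  exact ⟨k, hk, hkC⟩

/-- Approximate transports reach graph points arbitrarily close to the compact set of candidates
`(x', y - k)`, so the closed graph meets it. -/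
theorem inter_closedBall_subset_add [FiniteDimensional ℝ E] [FiniteDimensional ℝ F]
    {S H : E → Set F} {a : E} {b : F} {δ ρ R : ℝ} (hδ : 0 < δ) (hS : HasClosedGraph S)
    (hH : H ∈ genDerivSet (closedConvexification (coderivativeAround S a b δ)))
    {x x' : E} (hx : x ∈ Metric.closedBall a δ) (hx' : x' ∈ Metric.closedBall a δ)
    (hne : x ≠ x') (hR : ∀ k ∈ H (x - x'), ‖k‖ ≤ R) (hρ : ρ + R < δ) :
    S x ∩ Metric.closedBall b ρ ⊆ S x' + H (x - x') := by
  rintro y ⟨hy, hyb⟩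
  rw [mem_closedBall_iff_norm] at hyb
  set p := x - x' with hp
  have hp0 : p ≠ 0 := sub_ne_zero.mpr hne
  obtain ⟨k₀, hk₀⟩ := hH.1.nonempty p
  have hR0 : 0 ≤ R := (norm_nonneg _).trans (hR k₀ hk₀)
  let T : Set (WithLp 2 (E × F)) := (fun k => WithLp.toLp 2 (x', y - k)) '' H p
  have hT : IsCompact T := (hH.1.isCompact p).image (by fun_prop)
  obtain ⟨_, ⟨k, hk, rfl⟩, hkS⟩ := inter_nonempty_of_forall_dist_lt hT hS (fun ε hε => by
    obtain ⟨τ, hτ0, hτ1, hτε⟩ : ∃ τ : ℝ, 0 < τ ∧ τ < 1 ∧ τ * (‖p‖ + R) < ε / 2 := by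
      have hlim : Tendsto (fun τ : ℝ => τ * (‖p‖ + R)) (𝓝[>] 0) (𝓝 0) := by
        have : Tendsto (fun τ : ℝ => τ * (‖p‖ + R)) (𝓝 0) (𝓝 (0 * (‖p‖ + R))) :=
          (continuous_id.mul continuous_const).tendsto 0
        rw [zero_mul] at this
        exact this.mono_left nhdsWithin_le_nhds
      obtain ⟨τ, h1, h2, h3⟩ := ((hlim.eventually_lt_const (half_pos hε)).and
        ((eventually_nhdsWithin_of_eventually_nhds (eventually_lt_nhds one_pos)).and
          self_mem_nhdsWithin)).exists
      exact ⟨τ, h3, h2, h1⟩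
    -- Strict convexity of the ball: stopping before `x'` keeps the end off the sphere.
    have hend : x - (1 - τ) • p ∈ Metric.ball a δ := by
      have := strictConvex_closedBall ℝ a δ hx hx' hne hτ0 (sub_pos.mpr hτ1)
        (by ring : τ + (1 - τ) = 1)
      rw [interior_closedBall _ hδ.ne'] at this
      convert this using 1
      rw [hp]; module
    rw [mem_ball_iff_norm] at hend
    set ζ := min (ε / 2) (min (δ - (ρ + R)) (δ - ‖x - (1 - τ) • p - a‖)) with hζ
    have hζ0 : 0 < ζ := lt_min (half_pos hε) (lt_min (sub_pos.mpr hρ) (sub_pos.mpr hend))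
    have hζ1 : ζ ≤ ε / 2 := min_le_left _ _
    have hζ2 : ζ ≤ δ - (ρ + R) := (min_le_right _ _).trans (min_le_left _ _)
    have hζ3 : ζ ≤ δ - ‖x - (1 - τ) • p - a‖ := (min_le_right _ _).trans (min_le_right _ _)
    obtain ⟨z, hzS, hzd, hza⟩ := exists_graph_dist_lt_fst_mem_ball hδ hH
      (z := WithLp.toLp 2 (x, y)) hy hx (by rw [mem_closedBall_iff_norm]; exact hyb.trans (by linarith)) hζ0
    rw [dist_eq_norm] at hzd
    have hz1 : ‖z.fst - x‖ < ζ := (WithLp.norm_fst_le (p := 2) _ _).trans_lt hzd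
    have hz2 : ‖z.snd - y‖ < ζ := (WithLp.norm_snd_le (p := 2) _ _).trans_lt hzd
    obtain ⟨k, hk, hkS⟩ := exists_graph_of_ball_tube hS hH hp0
      (r := 1 - τ) ⟨by linarith, by linarith⟩ hzS hza
      (by
        rw [mem_ball_iff_norm]
        have e : z.fst - (1 - τ) • p - a = (z.fst - x) + (x - (1 - τ) • p - a) := by abel
        rw [e]
        linarith [norm_add_le (z.fst - x) (x - (1 - τ) • p - a)])
      hR
      (by
        have e : z.snd - b = (z.snd - y) + (y - b) := by abel
        rw [e]
        linarith [norm_add_le (z.snd - y) (y - b)])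
    refine ⟨_, ⟨k, hk, rfl⟩, _, hkS, ?_⟩
    have e : WithLp.toLp 2 (x', y - k) - (z + (1 - τ) • WithLp.toLp 2 (-p, -k)) =
        -(z - WithLp.toLp 2 (x, y)) + τ • WithLp.toLp 2 (-p, -k) := by
      have : WithLp.toLp 2 (x', y - k) = WithLp.toLp 2 (x, y) + WithLp.toLp 2 (-p, -k) := by
        rw [← WithLp.toLp_add, Prod.mk_add_mk, hp]
        congr 2 <;> abel
      rw [this]; module
    have hpk : ‖WithLp.toLp 2 (-p, -k)‖ ≤ ‖p‖ + R := by
      have : WithLp.toLp 2 (-p, -k) = WithLp.toLp 2 (-p, (0 : F)) + WithLp.toLp 2 ((0 : E), -k) := by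
        rw [← WithLp.toLp_add, Prod.mk_add_mk, add_zero, zero_add]
      rw [this]
      refine (norm_add_le _ _).trans ?_
      rw [WithLp.norm_toLp_fst, WithLp.norm_toLp_snd, norm_neg, norm_neg]
      linarith [hR k hk]
    rw [dist_eq_norm, e]
    refine (norm_add_le _ _).trans_lt ?_
    rw [norm_neg, norm_smul, Real.norm_of_nonneg hτ0.le]
    linarith [mul_le_mul_of_nonneg_left hpk hτ0.le])
  exact ⟨y - k, hkS, k, hk, sub_add_cancel _ _⟩

end SetValuedMaps

end VarAnalysis

/-- The radius `min (δ, δ / (5 ‖H‖⁺))` is computed in `[0, ∞]`, so that it equals `δ` when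
`‖H‖⁺ = 0`. -/
theorem mainTheorem6 (n m : ℕ)
    (S H : EuclideanSpace ℝ (Fin n) → Set (EuclideanSpace ℝ (Fin m)))
    (xbar : EuclideanSpace ℝ (Fin n)) (ybar : EuclideanSpace ℝ (Fin m))
    (δ : ℝ) (hδ : 0 < δ)
    (hS : VarAnalysis.HasClosedGraph S)
    (hH : H ∈ VarAnalysis.genDerivSet (VarAnalysis.closedConvexification
      (VarAnalysis.coderivativeAround S xbar ybar δ))) :
    ∀ δ' : ℝ≥0∞,
      δ' = min (ENNReal.ofReal δ) (ENNReal.ofReal δ / (5 * VarAnalysis.outerNorm H)) →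
      ∀ x' ∈ Metric.closedEBall xbar δ', ∀ x'' ∈ Metric.closedEBall xbar δ',
        S x' ∩ Metric.closedBall ybar (δ / 2) ⊆ S x'' + H (x' - x'') := by
  intro δ' hδ' x' hx' x'' hx''
  have hκ : VarAnalysis.outerNorm H * δ' ≤ ENNReal.ofReal (δ / 5) := by
    have h5 : 5 * (VarAnalysis.outerNorm H * δ') ≤ ENNReal.ofReal δ := by
      rw [← mul_assoc, hδ']
      exact (mul_le_mul_right (min_le_right _ _) _).trans ENNReal.mul_div_le
    rw [ENNReal.ofReal_div_of_pos (by norm_num), ENNReal.ofReal_ofNat,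
      ENNReal.le_div_iff_mul_le (by simp) (by simp), mul_comm]
    exact h5
  have hball : ∀ x ∈ Metric.closedEBall xbar δ', x ∈ Metric.closedBall xbar δ := fun x hx => by
    rw [Metric.mem_closedEBall] at hx
    have h := hx.trans (hδ'.trans_le (min_le_left _ _))
    rwa [edist_dist, ENNReal.ofReal_le_ofReal_iff hδ.le] at h
  -- The inequality in `genDerivSet` says nothing at `p = 0`; there `0 ∈ H 0` suffices.
  rcases eq_or_ne x' x'' with rfl | hne
  · rintro y ⟨hy, -⟩
    exact ⟨y, hy, 0, by simpa using hH.1.posHomogeneous.1, add_zero y⟩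
  -- `‖H‖⁺ δ' ≤ δ/5` and `‖x' - x''‖ ≤ 2δ'` give `R = 2δ/5`, and `δ/2 + 2δ/5 < δ`.
  · refine VarAnalysis.inter_closedBall_subset_add hδ hS hH (hball x' hx') (hball x'' hx'') hne
      (R := 2 * (δ / 5)) (fun k hk => ?_) (by linarith)
    have hp : ‖x' - x''‖ₑ ≤ δ' + δ' := by
      rw [← edist_eq_enorm_sub]
      rw [Metric.mem_closedEBall] at hx' hx''
      exact (edist_triangle_right _ _ xbar).trans (add_le_add hx' hx'')
    have hk' : ‖k‖ₑ ≤ ENNReal.ofReal (2 * (δ / 5)) := by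
      calc ‖k‖ₑ ≤ VarAnalysis.outerNorm H * ‖x' - x''‖ₑ :=
            hH.1.posHomogeneous.enorm_le (sub_ne_zero.mpr hne) hk
        _ ≤ VarAnalysis.outerNorm H * (δ' + δ') := by gcongr
        _ = VarAnalysis.outerNorm H * δ' + VarAnalysis.outerNorm H * δ' := mul_add _ _ _
        _ ≤ ENNReal.ofReal (δ / 5) + ENNReal.ofReal (δ / 5) := add_le_add hκ hκ
        _ = ENNReal.ofReal (2 * (δ / 5)) := by
            rw [← ENNReal.ofReal_add (by positivity) (by positivity), two_mul]
    rwa [← ofReal_norm, ENNReal.ofReal_le_ofReal_iff (by positivity)] at hk'
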